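/- **Theorem.** Let $n\ge 1$, and let $W\in\mathbb{R}^{N\times N}$ be the adjacency matrix, with entries $w_{ij}\ge 0$, of a weighted directed graph on $N$ vertices, with an edge from $j$ to $i$ exactly when $w_{ij}>0$. Let $L$ be its graph Laplacian, $[L]_{ij}=-w_{ij}$ for $i\ne j$ and $[L]_{ii}=\sum_{k\ne i}w_{ik}$. Assume that $L=L^{T}$ and that the graph contains a connected spanning tree, i.e. from some vertex there is a directed path to every other vertex. Let $\mathcal{RH}_\infty$ be the set of proper real rational transfer matrices without poles in the closed right half plane, and let $\|G\|_{\mathcal H_\infty}=\sup_{\operatorname{Re}s>0}\bar\sigma(G(s))$, where $\bar\sigma$ is the largest singular value. Let $U_{\mathrm{ref}}\in\mathcal{RH}_\infty$ be an $N$-vector, let $\Delta_0,\dots,\Delta_n\in\mathcal{RH}_\infty$ be $N\times N$ matrices, and consider the perturbed serial consensus system $$(sI+L)^nX=U_{\mathrm{ref}}+\Big(\sum_{k=0}^n\Delta_k s^kL^{n-k}\Big)X .$$ If $$\|\Delta_0\|_{\mathcal H_\infty}+\|\Delta_n\|_{\mathcal H_\infty}+\sum_{k=1}^{n-1}\|\Delta_k\|_{\mathcal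 H_\infty}\sqrt{\frac{k^k}{n^n}(n-k)^{n-k}}<1,$$ then the system achieves $n$-th order consensus. That is: the equation has a unique solution $X$ in real rational functions; $X$ is the Laplace transform of a trajectory $x=(x_1,\dots,x_N)$ that is continuous for $t>0$; and every such trajectory is $n$ times continuously differentiable for $t>0$ and satisfies $$\lim_{t\to\infty}\big|x_i^{(k)}(t)-x_j^{(k)}(t)\big|=0\qquad\text{for all vertices } i,j \text{ and all } k\in\{0,1,\dots,n-1\}.$$ The condition does not depend on the number $N$ of vertices except through the norms $\|\Delta_k\|_{\mathcal H_\infty}$. -/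

import Mathlib

open scoped ENNReal Topology

noncomputable section

namespace SerialConsensus

/-! ### Weighted directed graphs, given by their adjacency matrix -/

/-- The weighted graph Laplacian of the adjacency matrix `W`. -/
def graphLaplacian {ι : Type*} [Fintype ι] [DecidableEq ι] (W : Matrix ι ι ℝ) : Matrix ι ι ℝ :=
  Matrix.of fun i j => if i = j then ∑ k ∈ Finset.univ.erase i, W i k else -W i j

/-- The edge relation: there is an edge from `j` to `i` exactly when `W i j > 0`. -/
def Edge {ι : Type*} (W : Matrix ι ι ℝ) (j i : ι) : Prop := 0 < W i j

/-- The graph contains a connected spanning tree: from some vertex (the root) there is a directed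
path to every vertex. -/
def HasConnectedSpanningTree {ι : Type*} (W : Matrix ι ι ℝ) : Prop :=
  ∃ r : ι, ∀ j : ι, Relation.ReflTransGen (Edge W) r j

/-! ### Real rational transfer functions and the `H∞` norm -/

/-- The value of a real rational function at a complex point. -/
def evalC (f : RatFunc ℝ) (s : ℂ) : ℂ := RatFunc.eval (algebraMap ℝ ℂ) s f

/-- A scalar real rational function is in `RH∞`: it is proper, and stable, that is, it has no pole
in the closed right half plane. (`num` and `denom` are coprime.) -/
def IsRHInf (f : RatFunc ℝ) : Prop :=
  f.num.natDegree ≤ f.denom.natDegree ∧ ∀ s : ℂ, 0 ≤ s.re → Polynomial.aeval s f.denom ≠ 0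

/-- A transfer matrix is in `RH∞` if all its entries are. -/
def MatrixIsRHInf {ι κ : Type*} (G : Matrix ι κ (RatFunc ℝ)) : Prop := ∀ i j, IsRHInf (G i j)

/-- The `H∞` norm of a transfer matrix: the supremum over the open right half plane of the largest
singular value, that is, of the operator norm with respect to the Euclidean norm. -/
def hInfNorm {ι : Type*} [Fintype ι] [DecidableEq ι] (G : Matrix ι ι (RatFunc ℝ)) : ℝ≥0∞ :=
  ⨆ (s : ℂ) (_ : 0 < s.re),
    ‖Matrix.toEuclideanCLM (n := ι) (𝕜 := ℂ) (G.map fun f => evalC f s)‖ₑ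

/-! ### The perturbed serial consensus system -/

/-- `X` solves, over the field of real rational functions in `s`, the perturbed system
`(s I + L)ⁿ X = Uref + (∑_{k=0}^{n} Δ_k s^k L^{n-k}) X`. -/
def IsPerturbedSolution {ι : Type*} [Fintype ι] [DecidableEq ι] (n : ℕ) (L : Matrix ι ι ℝ)
    (Δ : ℕ → Matrix ι ι (RatFunc ℝ)) (Uref X : ι → RatFunc ℝ) : Prop :=
  let s : RatFunc ℝ := RatFunc.X
  let Ls : Matrix ι ι (RatFunc ℝ) := L.map RatFunc.C
  ((s • (1 : Matrix ι ι (RatFunc ℝ)) + Ls) ^ n).mulVec X =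
    Uref + (∑ k ∈ Finset.range (n + 1), Δ k * (s ^ k • Ls ^ (n - k))).mulVec X

/-- `F` is the (one-sided) Laplace transform of the signal `f`: on some right half plane the
Laplace integral of `f` converges absolutely and has the value `F(s)`. -/
def HasLaplaceTransform (f : ℝ → ℝ) (F : RatFunc ℝ) : Prop :=
  ∃ σ : ℝ, ∀ s : ℂ, σ < s.re →
    MeasureTheory.IntegrableOn (fun t : ℝ => Complex.exp (-(s * t)) * (f t : ℂ)) (Set.Ioi 0) ∧
    ∫ t in Set.Ioi (0 : ℝ), Complex.exp (-(s * t)) * (f t : ℂ) = evalC F s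

/-- `x` is the time-domain trajectory with Laplace transform `X`: each component is continuous for
`t > 0` and is transformed to the corresponding component of `X`. -/
def IsTrajectory {ι : Type*} (x : ι → ℝ → ℝ) (X : ι → RatFunc ℝ) : Prop :=
  ∀ i, ContinuousOn (x i) (Set.Ioi 0) ∧ HasLaplaceTransform (x i) (X i)

/-- The trajectory `x` achieves `n`-th order consensus: the components are `n` times continuously
differentiable for `t > 0`, and the differences of their derivatives of each order
`k = 0, …, n - 1` tend to zero. -/
def AchievesConsensus {ι : Type*} (n : ℕ) (x : ι → ℝ → ℝ) : Prop :=
  (∀ i, ContDiffOn ℝ n (x i) (Set.Ioi 0)) ∧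
  ∀ i j, ∀ k < n, Filter.Tendsto
    (fun t : ℝ => |iteratedDeriv k (x i) t - iteratedDeriv k (x j) t|) Filter.atTop (𝓝 0)

end SerialConsensus

end

namespace SerialConsensus

open Filter Polynomial MeasureTheory

/-! ### Evaluation of real rational functions -/

/-! Put `Z = (sI + L)^n X`, evaluated at a point `s` with `Re s > 0`. The symmetric Laplacian is
positive semidefinite, so in an orthonormal eigenbasis passing from `Z` to `s^k L^(n-k) X`
multiplies each coordinate by `s^k λ^(n-k) / (s+λ)^n` with `λ ≥ 0`. Since `|s+λ|² ≥ |s|² + λ²`,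
weighted AM-GM bounds this factor by `√(k^k (n-k)^(n-k) / n^n)`, which is `1` for `k = 0` and `k =
n` (`norm_pow_mul_pow_le_gain`). The hypothesis therefore says that the perturbation has some gain
`ρ < 1`, and `‖Z‖ ≤ ‖U‖ + ρ‖Z‖` gives `‖Z‖ ≤ ‖U‖ / (1-ρ)`.

Two bounds follow (`exists_bounds_of_isPerturbedSolution`). The factor for `k = n` gives `|s|^n ‖X‖
≤ ‖Z‖`, so `X = 0` when `U = 0`, whence unique solvability, and `X` is strictly proper when `U` is
proper. Because the graph has a spanning tree, the kernel of `L` consists of constant vectors, which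
drop out of `X_i - X_j`; the remaining eigenvalues are positive, so `|X_i - X_j| ≤ C‖U‖` without any
singularity at `s = 0`. As `U` is stable, `X_i - X_j` has no pole in the closed right half plane.

Partial fractions turn this into time-domain statements: entries of `X` come from exponential
polynomials, and differences from those with exponents in the open left half plane, which decay with
all derivatives. Uniqueness of the inverse Laplace transform, by Fourier inversion, extends this to
every continuous trajectory. -/

theorem eventually_aeval_ne_zero {p : ℝ[X]} (hp : p ≠ 0) :
    ∀ᶠ s : ℂ in cofinite, aeval s p ≠ 0 := by
  refine ((p.rootSet_finite ℂ).subset ?_)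
  intro s hs
  simp only [ne_eq, Set.mem_compl_iff, Set.mem_ofPred_eq, not_not] at hs
  exact (mem_rootSet.2 ⟨hp, hs⟩)

theorem evalC_eq_div (f : RatFunc ℝ) (s : ℂ) :
    evalC f s = aeval s f.num / aeval s f.denom := rfl

theorem evalC_zero (s : ℂ) : evalC 0 s = 0 := RatFunc.eval_zero ..

theorem evalC_one (s : ℂ) : evalC 1 s = 1 := RatFunc.eval_one ..

theorem evalC_C (r : ℝ) (s : ℂ) : evalC (RatFunc.C r) s = r := RatFunc.eval_C ..

theorem evalC_X (s : ℂ) : evalC RatFunc.X s = s := RatFunc.eval_X ..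

/-- Evaluation divides the reduced numerator by the reduced denominator, with value `0` at a pole,
so it respects the field operations only off a finite set. All later estimates tolerate finitely
many exceptional points. -/
theorem eventually_evalC_add (f g : RatFunc ℝ) :
    ∀ᶠ s in cofinite, evalC (f + g) s = evalC f s + evalC g s := by
  filter_upwards [eventually_aeval_ne_zero f.denom_ne_zero,
    eventually_aeval_ne_zero g.denom_ne_zero] with s hf hg
  exact RatFunc.eval_add _ _ hf hg

theorem eventually_evalC_mul (f g : RatFunc ℝ) :
    ∀ᶠ s in cofinite, evalC (f * g) s = evalC f s * evalC g s := by
  filter_upwards [eventually_aeval_ne_zero f.denom_ne_zero,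
    eventually_aeval_ne_zero g.denom_ne_zero] with s hf hg
  exact RatFunc.eval_mul _ _ hf hg

theorem eventually_evalC_sub (f g : RatFunc ℝ) :
    ∀ᶠ s in cofinite, evalC (f - g) s = evalC f s - evalC g s := by
  filter_upwards [eventually_evalC_add (f - g) g] with s h
  rw [sub_add_cancel] at h
  rw [h, add_sub_cancel_right]

theorem eventually_evalC_sum {κ : Type*} (t : Finset κ) (f : κ → RatFunc ℝ) :
    ∀ᶠ s in cofinite, evalC (∑ k ∈ t, f k) s = ∑ k ∈ t, evalC (f k) s := by
  classical
  induction t using Finset.induction_on with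
  | empty => simp [evalC_zero]
  | insert a t ha ih =>
    filter_upwards [ih, eventually_evalC_add (f a) (∑ k ∈ t, f k)] with s h1 h2
    rw [Finset.sum_insert ha, Finset.sum_insert ha, h2, h1]

theorem eq_zero_of_infinite_evalC_eq_zero {f : RatFunc ℝ} {S : Set ℂ} (hS : S.Infinite)
    (h : ∀ᶠ s in cofinite, s ∈ S → evalC f s = 0) : f = 0 := by
  by_contra hf
  have hnum : f.num ≠ 0 := RatFunc.num_ne_zero hf
  have h2 : ∀ᶠ s in cofinite, s ∉ S := by
    filter_upwards [h, eventually_aeval_ne_zero hnum,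
      eventually_aeval_ne_zero f.denom_ne_zero] with s h1 h2 h3 hs
    exact div_ne_zero h2 h3 (h1 hs)
  exact hS (by simpa [eventually_cofinite] using h2)

theorem infinite_re_pos : {s : ℂ | 0 < s.re}.Infinite := by
  refine Set.infinite_of_injective_forall_mem (f := fun n : ℕ => ((n : ℂ) + 1)) ?_ ?_
  · intro a b h
    simpa using h
  · intro n
    simp only [Set.mem_ofPred_eq, Complex.add_re, Complex.natCast_re, Complex.one_re]
    positivity

/-! ### Entrywise evaluation of transfer matrices. -/

section Matrix

variable {ι : Type*} [Fintype ι] [DecidableEq ι]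

/-- Entrywise evaluation of a transfer matrix. -/
noncomputable def evalMatrix (A : Matrix ι ι (RatFunc ℝ)) (s : ℂ) : Matrix ι ι ℂ := A.map fun f => evalC f s

omit [DecidableEq ι] in
theorem eventually_evalMatrix_mul (A B : Matrix ι ι (RatFunc ℝ)) :
    ∀ᶠ s in cofinite, evalMatrix (A * B) s = evalMatrix A s * evalMatrix B s := by
  have h1 : ∀ᶠ s in cofinite, ∀ i j, evalC (∑ k, A i k * B k j) s = ∑ k, evalC (A i k * B k j) s :=
    eventually_all.2 fun i => eventually_all.2 fun j => eventually_evalC_sum _ _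
  have h2 : ∀ᶠ s in cofinite, ∀ i j k, evalC (A i k * B k j) s = evalC (A i k) s * evalC (B k j) s :=
    eventually_all.2 fun i => eventually_all.2 fun j => eventually_all.2 fun k =>
      eventually_evalC_mul _ _
  filter_upwards [h1, h2] with s h1 h2
  ext i j
  simp only [evalMatrix, Matrix.map_apply, Matrix.mul_apply, h1, h2]

omit [Fintype ι] [DecidableEq ι] in
theorem eventually_evalMatrix_add [Finite ι] (A B : Matrix ι ι (RatFunc ℝ)) :
    ∀ᶠ s in cofinite, evalMatrix (A + B) s = evalMatrix A s + evalMatrix B s := by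
  have h1 : ∀ᶠ s in cofinite, ∀ i j, evalC (A i j + B i j) s = evalC (A i j) s + evalC (B i j) s :=
    eventually_all.2 fun i => eventually_all.2 fun j => eventually_evalC_add _ _
  filter_upwards [h1] with s h1
  ext i j
  simp only [evalMatrix, Matrix.map_apply, Matrix.add_apply, h1]

omit [Fintype ι] [DecidableEq ι] in
theorem eventually_evalMatrix_smul [Finite ι] (f : RatFunc ℝ) (A : Matrix ι ι (RatFunc ℝ)) :
    ∀ᶠ s in cofinite, evalMatrix (f • A) s = evalC f s • evalMatrix A s := by
  have h1 : ∀ᶠ s in cofinite, ∀ i j, evalC (f * A i j) s = evalC f s * evalC (A i j) s :=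
    eventually_all.2 fun i => eventually_all.2 fun j => eventually_evalC_mul _ _
  filter_upwards [h1] with s h1
  ext i j
  simp only [evalMatrix, Matrix.map_apply, Matrix.smul_apply, smul_eq_mul, h1]

omit [Fintype ι] in
theorem evalMatrix_one (s : ℂ) : evalMatrix (1 : Matrix ι ι (RatFunc ℝ)) s = 1 :=
  Matrix.map_one _ (evalC_zero s) (evalC_one s)

theorem eventually_evalMatrix_pow (A : Matrix ι ι (RatFunc ℝ)) (n : ℕ) :
    ∀ᶠ s in cofinite, evalMatrix (A ^ n) s = evalMatrix A s ^ n := by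
  induction n with
  | zero => simp [evalMatrix_one]
  | succ n ih =>
    filter_upwards [ih, eventually_evalMatrix_mul (A ^ n) A] with s h1 h2
    rw [pow_succ, pow_succ, h2, h1]

omit [Fintype ι] [DecidableEq ι] in
theorem eventually_evalMatrix_sum [Finite ι] {κ : Type*} (t : Finset κ)
    (A : κ → Matrix ι ι (RatFunc ℝ)) :
    ∀ᶠ s in cofinite, evalMatrix (∑ k ∈ t, A k) s = ∑ k ∈ t, evalMatrix (A k) s := by
  have h1 : ∀ᶠ s in cofinite, ∀ i j,
      evalC (∑ k ∈ t, A k i j) s = ∑ k ∈ t, evalC (A k i j) s :=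
    eventually_all.2 fun i => eventually_all.2 fun j => eventually_evalC_sum _ _
  filter_upwards [h1] with s h1
  ext i j
  simp only [evalMatrix, Matrix.map_apply, Matrix.sum_apply, h1]

omit [DecidableEq ι] in
theorem eventually_evalC_mulVec (A : Matrix ι ι (RatFunc ℝ)) (v : ι → RatFunc ℝ) :
    ∀ᶠ s in cofinite, (fun i => evalC (A.mulVec v i) s) =
      (evalMatrix A s).mulVec fun i => evalC (v i) s := by
  have h1 : ∀ᶠ s in cofinite, ∀ i, evalC (∑ k, A i k * v k) s = ∑ k, evalC (A i k * v k) s :=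
    eventually_all.2 fun i => eventually_evalC_sum _ _
  have h2 : ∀ᶠ s in cofinite, ∀ i k, evalC (A i k * v k) s = evalC (A i k) s * evalC (v k) s :=
    eventually_all.2 fun i => eventually_all.2 fun k => eventually_evalC_mul _ _
  filter_upwards [h1, h2] with s h1 h2
  ext i
  simp only [evalMatrix, Matrix.map_apply, Matrix.mulVec, dotProduct, h1, h2]

omit [Fintype ι] [DecidableEq ι] in
theorem evalMatrix_map_C (L : Matrix ι ι ℝ) (s : ℂ) :
    evalMatrix (L.map RatFunc.C) s = L.map Complex.ofReal := by
  ext i j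
  simp [evalMatrix, evalC_C]

/-- Reduces the identity over the field of rational functions to complex linear algebra at a fixed
`s`, where norms are available. -/
theorem eventually_eval_isPerturbedSolution {n : ℕ} {L : Matrix ι ι ℝ}
    {Δ : ℕ → Matrix ι ι (RatFunc ℝ)} {U X : ι → RatFunc ℝ}
    (h : IsPerturbedSolution n L Δ U X) :
    ∀ᶠ s in cofinite,
      ((s • (1 : Matrix ι ι ℂ) + L.map Complex.ofReal) ^ n).mulVec (fun i => evalC (X i) s) =
        (fun i => evalC (U i) s) +
        ∑ k ∈ Finset.range (n + 1), (evalMatrix (Δ k) s).mulVec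
          ((s ^ k • (L.map Complex.ofReal) ^ (n - k)).mulVec fun i => evalC (X i) s) := by
  unfold IsPerturbedSolution at h
  set Ls : Matrix ι ι (RatFunc ℝ) := L.map RatFunc.C with hLs
  set P := (RatFunc.X : RatFunc ℝ) • (1 : Matrix ι ι (RatFunc ℝ)) with hP
  have e1 := eventually_evalMatrix_smul RatFunc.X (1 : Matrix ι ι (RatFunc ℝ))
  have e2 := eventually_evalMatrix_add P Ls
  have e3 := eventually_evalMatrix_pow (P + Ls) n
  have e4 := eventually_evalC_mulVec ((P + Ls) ^ n) X
  have e5 : ∀ᶠ s in cofinite, ∀ k ∈ Finset.range (n + 1),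
      evalMatrix (Δ k * ((RatFunc.X : RatFunc ℝ) ^ k • Ls ^ (n - k))) s =
      evalMatrix (Δ k) s * (s ^ k • (L.map Complex.ofReal) ^ (n - k)) := by
    refine (Finset.eventually_all _).2 fun k _ => ?_
    have hX : (RatFunc.X : RatFunc ℝ) ^ k = algebraMap ℝ[X] (RatFunc ℝ) (Polynomial.X ^ k) := by
      simp
    filter_upwards [eventually_evalMatrix_mul (Δ k) ((RatFunc.X : RatFunc ℝ) ^ k • Ls ^ (n - k)),
      eventually_evalMatrix_smul ((RatFunc.X : RatFunc ℝ) ^ k) (Ls ^ (n - k)),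
      eventually_evalMatrix_pow Ls (n - k)] with s h1 h2 h3
    rw [h1, h2, h3, hLs, evalMatrix_map_C, hX, evalC, RatFunc.eval_algebraMap]
    simp
  have e6 := eventually_evalMatrix_sum (Finset.range (n + 1))
    fun k => Δ k * ((RatFunc.X : RatFunc ℝ) ^ k • Ls ^ (n - k))
  have e7 := eventually_evalC_mulVec
    (∑ k ∈ Finset.range (n + 1), Δ k * ((RatFunc.X : RatFunc ℝ) ^ k • Ls ^ (n - k))) X
  have e8 : ∀ᶠ s in cofinite, ∀ i, evalC (U i +
      (∑ k ∈ Finset.range (n + 1), Δ k * ((RatFunc.X : RatFunc ℝ) ^ k • Ls ^ (n - k))).mulVec X i) s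
      = evalC (U i) s + evalC ((∑ k ∈ Finset.range (n + 1),
        Δ k * ((RatFunc.X : RatFunc ℝ) ^ k • Ls ^ (n - k))).mulVec X i) s :=
    eventually_all.2 fun i => eventually_evalC_add _ _
  filter_upwards [e1, e2, e3, e4, e5, e6, e7, e8] with s e1 e2 e3 e4 e5 e6 e7 e8
  rw [e3, e2, hP, e1, evalMatrix_one, evalC_X, hLs, evalMatrix_map_C] at e4
  rw [← e4, ← hLs, ← hP, h]
  funext i
  simp only [Pi.add_apply]
  rw [e8]
  congr 1
  rw [congrFun e7 i, e6, Finset.sum_congr rfl e5, Matrix.sum_mulVec]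
  simp only [Matrix.mulVec_mulVec]

end Matrix

/-! ### Poles and properness from pointwise bounds -/

/-- The path `s₀ + t`, `t ↓ 0`, lies in the open half plane even if `s₀` is imaginary, and
eventually avoids any finite set. In the limit `|num| ≤ g |denom|` makes a zero of the denominator a
zero of the numerator, against coprimality. -/
theorem aeval_denom_ne_zero_of_bound {f : RatFunc ℝ} {g : ℂ → ℝ} {s₀ : ℂ} (hs₀ : 0 ≤ s₀.re)
    (hg : ContinuousAt g s₀)
    (h : ∀ᶠ s in cofinite, 0 < s.re → ‖evalC f s‖ ≤ g s) : aeval s₀ f.denom ≠ 0 := by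
  intro h0
  have hpath : Tendsto (fun t : ℝ => s₀ + t) (𝓝[>] 0) (𝓝[≠] s₀) := by
    refine tendsto_nhdsWithin_iff.2 ⟨?_, ?_⟩
    · have : ContinuousAt (fun t : ℝ => s₀ + t) 0 := by fun_prop
      have h2 := this.tendsto
      simp only [Complex.ofReal_zero, add_zero] at h2
      exact h2.mono_left nhdsWithin_le_nhds
    · filter_upwards [self_mem_nhdsWithin] with t ht
      simpa using (ne_of_gt ht)
  have hn : Tendsto (fun t : ℝ => s₀ + t) (𝓝[>] 0) (𝓝 s₀) := hpath.mono_right nhdsWithin_le_nhds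
  have hb : ∀ᶠ t : ℝ in 𝓝[>] 0,
      ‖aeval (s₀ + t) f.num‖ ≤ g (s₀ + t) * ‖aeval (s₀ + (t : ℂ)) f.denom‖ := by
    have h' := (hpath.mono_right (nhdsNE_le_cofinite s₀)).eventually
      (h.and (eventually_aeval_ne_zero f.denom_ne_zero))
    filter_upwards [h', self_mem_nhdsWithin] with t ht ht0
    have h1 := ht.1 (by simpa using add_pos_of_nonneg_of_pos hs₀ ht0)
    rw [evalC_eq_div, norm_div, div_le_iff₀ (norm_pos_iff.2 ht.2)] at h1
    exact h1
  have c1 : Tendsto (fun t : ℝ => ‖aeval (s₀ + t) f.num‖) (𝓝[>] 0) (𝓝 ‖aeval s₀ f.num‖) :=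
    ((f.num.continuous_aeval (A := ℂ)).norm.tendsto s₀).comp hn
  have c2 : Tendsto (fun t : ℝ => g (s₀ + t) * ‖aeval (s₀ + (t : ℂ)) f.denom‖) (𝓝[>] 0)
      (𝓝 (g s₀ * ‖aeval s₀ f.denom‖)) :=
    (hg.tendsto.comp hn).mul (((f.denom.continuous_aeval (A := ℂ)).norm.tendsto s₀).comp hn)
  have h1 := le_of_tendsto_of_tendsto c1 c2 hb
  rw [h0, norm_zero, mul_zero, norm_le_zero_iff] at h1
  obtain ⟨a, b, hab⟩ := f.isCoprime_num_denom
  have := congrArg (aeval s₀) hab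
  simp [h0, h1] at this

theorem evalC_ofReal (f : RatFunc ℝ) (t : ℝ) :
    evalC f t = ((f.num.eval t / f.denom.eval t : ℝ) : ℂ) := by
  rw [evalC_eq_div, Complex.ofReal_div]
  congr 1 <;> exact aeval_algebraMap_apply_eq_algebraMap_eval t _

theorem tendsto_ofReal_atTop_cofinite : Tendsto (fun t : ℝ => (t : ℂ)) atTop cofinite :=
  (Complex.ofReal_injective.tendsto_cofinite).mono_left atTop_le_cofinite

theorem degree_num_lt_of_bound {f : RatFunc ℝ} {g : ℂ → ℝ}
    (hg : Tendsto (fun t : ℝ => g t) atTop (𝓝 0))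
    (h : ∀ᶠ s in cofinite, 0 < s.re → ‖evalC f s‖ ≤ g s) : f.num.degree < f.denom.degree := by
  rw [← div_tendsto_atTop_zero_iff_degree_lt _ _ f.denom_ne_zero]
  refine squeeze_zero_norm' ?_ hg
  filter_upwards [tendsto_ofReal_atTop_cofinite.eventually h, eventually_gt_atTop 0] with t ht ht0
  have := ht (by simpa using ht0)
  rwa [evalC_ofReal, Complex.norm_real] at this

theorem continuousAt_evalC {f : RatFunc ℝ} {s : ℂ} (h : aeval s f.denom ≠ 0) :
    ContinuousAt (evalC f) s :=
  (f.num.continuous_aeval.continuousAt).div (f.denom.continuous_aeval.continuousAt) h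

theorem exists_tendsto_evalC {f : RatFunc ℝ} (h : f.num.natDegree ≤ f.denom.natDegree) :
    ∃ c : ℂ, Tendsto (fun t : ℝ => evalC f t) atTop (𝓝 c) := by
  suffices ∃ c : ℝ, Tendsto (fun t : ℝ => f.num.eval t / f.denom.eval t) atTop (𝓝 c) by
    obtain ⟨c, hc⟩ := this
    refine ⟨c, ?_⟩
    simp only [evalC_ofReal]
    exact (Complex.continuous_ofReal.tendsto c).comp hc
  have hd : f.num.degree ≤ f.denom.degree := by
    rw [degree_eq_natDegree f.denom_ne_zero]
    exact degree_le_of_natDegree_le h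
  rcases hd.lt_or_eq with hlt | heq
  · exact ⟨0, (div_tendsto_atTop_zero_iff_degree_lt _ _ f.denom_ne_zero).2 hlt⟩
  · exact ⟨_, div_tendsto_atTop_leadingCoeff_div_of_degree_eq _ _ heq⟩

/-! ### Exponential polynomials -/

/-- Complex exponential polynomials with exponents in `S`. -/
def expPoly (S : Set ℂ) : Submodule ℂ (ℝ → ℂ) :=
  Submodule.span ℂ {y | ∃ a ∈ S, ∃ m : ℕ, y = fun t : ℝ => (t : ℂ) ^ m * Complex.exp (a * t)}

theorem expPoly_generator_mem {S : Set ℂ} {a : ℂ} (ha : a ∈ S) (m : ℕ) :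
    (fun t : ℝ => (t : ℂ) ^ m * Complex.exp (a * t)) ∈ expPoly S :=
  Submodule.subset_span ⟨a, ha, m, rfl⟩

theorem hasDerivAt_pow_mul_exp (a : ℂ) (m : ℕ) (t : ℝ) :
    HasDerivAt (fun t : ℝ => (t : ℂ) ^ m * Complex.exp (a * t))
      (m * ((t : ℂ) ^ (m - 1) * Complex.exp (a * t)) + a * ((t : ℂ) ^ m * Complex.exp (a * t))) t := by
  have h1 : HasDerivAt (fun z : ℂ => z ^ m * Complex.exp (a * z))
      (m * (t : ℂ) ^ (m - 1) * Complex.exp (a * t) + (t : ℂ) ^ m * (Complex.exp (a * t) * (a * 1)))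
      (t : ℂ) :=
    (hasDerivAt_pow m (t : ℂ)).mul (((hasDerivAt_id (t : ℂ)).const_mul a).cexp)
  convert h1.comp_ofReal using 1
  ring

theorem exists_hasDerivAt_of_mem_expPoly {S : Set ℂ} {y : ℝ → ℂ} (hy : y ∈ expPoly S) :
    ∃ y' ∈ expPoly S, ∀ t, HasDerivAt y (y' t) t := by
  induction hy using Submodule.span_induction with
  | mem y h =>
    obtain ⟨a, ha, m, rfl⟩ := h
    exact ⟨_, (expPoly S).add_mem ((expPoly S).smul_mem (m : ℂ) (expPoly_generator_mem ha (m - 1)))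
      ((expPoly S).smul_mem a (expPoly_generator_mem ha m)), hasDerivAt_pow_mul_exp a m⟩
  | zero => exact ⟨0, Submodule.zero_mem _, fun t => hasDerivAt_const t 0⟩
  | add x y _ _ hx hy =>
    obtain ⟨x', hx', hx⟩ := hx
    obtain ⟨y', hy', hy⟩ := hy
    exact ⟨_, (expPoly S).add_mem hx' hy', fun t => (hx t).add (hy t)⟩
  | smul c y _ hy =>
    obtain ⟨y', hy', hy⟩ := hy
    exact ⟨_, (expPoly S).smul_mem c hy', fun t => (hy t).const_smul c⟩

theorem contDiff_of_mem_expPoly {S : Set ℂ} {y : ℝ → ℂ} (hy : y ∈ expPoly S) (n : ℕ) :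
    ContDiff ℝ n y := by
  induction n generalizing y with
  | zero =>
    obtain ⟨y', -, h⟩ := exists_hasDerivAt_of_mem_expPoly hy
    exact contDiff_zero.2 (continuous_iff_continuousAt.2 fun t => (h t).continuousAt)
  | succ n ih =>
    obtain ⟨y', hy', h⟩ := exists_hasDerivAt_of_mem_expPoly hy
    push_cast
    rw [contDiff_succ_iff_deriv]
    refine ⟨fun t => (h t).differentiableAt, by simp, ?_⟩
    rw [show deriv y = y' from funext fun t => (h t).deriv]
    exact ih hy'

theorem exists_iteratedDeriv_re {S : Set ℂ} (k : ℕ) {y : ℝ → ℂ} (hy : y ∈ expPoly S) :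
    ∃ z ∈ expPoly S, iteratedDeriv k (fun t => (y t).re) = fun t => (z t).re := by
  induction k generalizing y with
  | zero => exact ⟨y, hy, by simp⟩
  | succ k ih =>
    obtain ⟨y', hy', h⟩ := exists_hasDerivAt_of_mem_expPoly hy
    have hd : deriv (fun t => (y t).re) = fun t => (y' t).re :=
      funext fun t => (Complex.reCLM.hasFDerivAt.comp_hasDerivAt t (h t)).deriv
    rw [iteratedDeriv_succ', hd]
    exact ih hy'

theorem tendsto_pow_mul_exp_zero {a : ℂ} (ha : a.re < 0) (m : ℕ) :
    Tendsto (fun t : ℝ => (t : ℂ) ^ m * Complex.exp (a * t)) atTop (𝓝 0) := by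
  rw [tendsto_zero_iff_norm_tendsto_zero]
  refine (tendsto_rpow_mul_exp_neg_mul_atTop_nhds_zero m (-a.re) (by linarith)).congr' ?_
  filter_upwards [eventually_ge_atTop 0] with t ht
  simp [Complex.norm_exp, abs_of_nonneg ht]

theorem tendsto_zero_of_mem_expPoly {S : Set ℂ} (hS : ∀ a ∈ S, a.re < 0) {y : ℝ → ℂ}
    (hy : y ∈ expPoly S) : Tendsto y atTop (𝓝 0) := by
  induction hy using Submodule.span_induction with
  | mem y h =>
    obtain ⟨a, ha, m, rfl⟩ := h
    exact tendsto_pow_mul_exp_zero (hS a ha) m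
  | zero => exact tendsto_const_nhds
  | add x y _ _ hx hy =>
    have h := hx.add hy
    rw [add_zero] at h
    exact h
  | smul c y _ hy =>
    have h := hy.const_smul c
    rw [smul_zero] at h
    exact h

/-! ### Laplace transforms of complex signals -/

/-- On the half plane `re s > σ` the Laplace integral of `y` converges absolutely to `G s`. -/
def HasLaplaceOn (y : ℝ → ℂ) (σ : ℝ) (G : ℂ → ℂ) : Prop :=
  ∀ s : ℂ, σ < s.re →
    IntegrableOn (fun t : ℝ => Complex.exp (-(s * t)) * y t) (Set.Ioi 0) ∧
    ∫ t in Set.Ioi (0 : ℝ), Complex.exp (-(s * t)) * y t = G s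

theorem HasLaplaceOn.mono {y : ℝ → ℂ} {σ τ : ℝ} {G : ℂ → ℂ} (h : HasLaplaceOn y σ G)
    (hστ : σ ≤ τ) : HasLaplaceOn y τ G := fun s hs => h s (hστ.trans_lt hs)

theorem HasLaplaceOn.congr {y : ℝ → ℂ} {σ : ℝ} {G H : ℂ → ℂ} (h : HasLaplaceOn y σ G)
    (hGH : ∀ s : ℂ, σ < s.re → G s = H s) : HasLaplaceOn y σ H :=
  fun s hs => ⟨(h s hs).1, (h s hs).2.trans (hGH s hs)⟩

theorem HasLaplaceOn.add {y z : ℝ → ℂ} {σ : ℝ} {G H : ℂ → ℂ} (hy : HasLaplaceOn y σ G)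
    (hz : HasLaplaceOn z σ H) : HasLaplaceOn (y + z) σ (G + H) := by
  intro s hs
  obtain ⟨a, b⟩ := hy s hs
  obtain ⟨c, d⟩ := hz s hs
  simp only [Pi.add_apply, mul_add]
  exact ⟨a.add c, by rw [integral_add a c, b, d]⟩

theorem HasLaplaceOn.const_smul {y : ℝ → ℂ} {σ : ℝ} {G : ℂ → ℂ} (hy : HasLaplaceOn y σ G)
    (c : ℂ) : HasLaplaceOn (c • y) σ (c • G) := by
  intro s hs
  obtain ⟨a, b⟩ := hy s hs
  simp only [Pi.smul_apply, smul_eq_mul, mul_left_comm _ c]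
  exact ⟨a.const_mul c, by rw [integral_const_mul, b]⟩

theorem HasLaplaceOn.sub {y z : ℝ → ℂ} {σ : ℝ} {G H : ℂ → ℂ} (hy : HasLaplaceOn y σ G)
    (hz : HasLaplaceOn z σ H) : HasLaplaceOn (y - z) σ (G - H) := by
  have := hy.add (hz.const_smul (-1))
  simpa [sub_eq_add_neg] using this

theorem integrableOn_pow_mul_exp {a : ℂ} (ha : a.re < 0) (m : ℕ) :
    IntegrableOn (fun t : ℝ => (t : ℂ) ^ m * Complex.exp (a * t)) (Set.Ioi 0) := by
  have h1 := integrableOn_rpow_mul_exp_neg_mul_rpow (p := 1) (s := m) (b := -a.re)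
    (by have : (0 : ℝ) ≤ m := m.cast_nonneg
        linarith) one_pos (by linarith)
  refine Integrable.mono' h1 ?_ ?_
  · exact (Continuous.aestronglyMeasurable (by fun_prop))
  · refine (ae_restrict_iff' measurableSet_Ioi).2 (ae_of_all _ fun t ht => ?_)
    simp [Complex.norm_exp, abs_of_pos (Set.mem_Ioi.1 ht)]

theorem integral_pow_mul_exp {a : ℂ} (ha : a.re < 0) (m : ℕ) :
    ∫ t in Set.Ioi (0 : ℝ), (t : ℂ) ^ m * Complex.exp (a * t) = m.factorial / (-a) ^ (m + 1) := by
  have ha0 : a ≠ 0 := by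
    rintro rfl
    simp at ha
  induction m with
  | zero =>
    simp only [pow_zero, one_mul, integral_exp_mul_complex_Ioi ha 0]
    simp [neg_div, div_neg]
  | succ m ih =>
    have i1 := (integrableOn_pow_mul_exp ha m).const_mul ((m + 1 : ℕ) : ℂ)
    have i2 := (integrableOn_pow_mul_exp ha (m + 1)).const_mul a
    -- The derivative of `t^(m+1) e^(at)` integrates to `0`, as both boundary values vanish; this is
    -- the recursion in `m`.
    have h := integral_Ioi_of_hasDerivAt_of_tendsto
      (a := 0) (f := fun t : ℝ => (t : ℂ) ^ (m + 1) * Complex.exp (a * t))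
      (Continuous.continuousWithinAt (by fun_prop))
      (fun t _ => hasDerivAt_pow_mul_exp a (m + 1) t) (i1.add i2)
      (tendsto_pow_mul_exp_zero ha (m + 1))
    simp only [Nat.add_sub_cancel] at h
    rw [integral_add i1 i2, integral_const_mul, integral_const_mul, ih] at h
    have hm : (-a) ^ (m + 1) ≠ 0 := pow_ne_zero _ (neg_ne_zero.2 ha0)
    simp only [Complex.ofReal_zero, ne_eq, Nat.succ_ne_zero, not_false_eq_true, zero_pow, zero_mul,
      sub_zero] at h
    rw [pow_succ (-a) (m + 1), eq_div_iff (mul_ne_zero hm (neg_ne_zero.2 ha0))]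
    rw [Nat.factorial_succ]
    field_simp at h
    push_cast at h ⊢
    linear_combination -h

theorem hasLaplaceOn_pow_mul_exp (a : ℂ) (m : ℕ) :
    HasLaplaceOn (fun t : ℝ => (t : ℂ) ^ m * Complex.exp (a * t)) a.re
      (fun s => m.factorial / (s - a) ^ (m + 1)) := by
  intro s hs
  have hre : (a - s).re < 0 := by simpa using hs
  have he : (fun t : ℝ => Complex.exp (-(s * t)) * ((t : ℂ) ^ m * Complex.exp (a * t))) =
      fun t : ℝ => (t : ℂ) ^ m * Complex.exp ((a - s) * t) := by
    funext t
    rw [mul_left_comm, ← Complex.exp_add]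
    congr 2
    ring
  rw [he]
  refine ⟨integrableOn_pow_mul_exp hre m, ?_⟩
  rw [integral_pow_mul_exp hre m, neg_sub]

/-- Inversion of the Laplace transform by partial fractions. -/
theorem exists_expPoly_hasLaplaceOn (S : Set ℂ) (p q : ℂ[X]) (hS : ∀ z, q.IsRoot z → z ∈ S)
    (hpq : p.degree < q.degree) :
    ∃ y ∈ expPoly S, ∃ σ : ℝ, HasLaplaceOn y σ (fun s => p.eval s / q.eval s) ∧
      ∀ s : ℂ, σ < s.re → q.eval s ≠ 0 := by
  induction hd : q.natDegree generalizing p q with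
  | zero =>
    have hq0 : q ≠ 0 := by
      rintro rfl
      simp at hpq
    have hp : p = 0 := by
      rw [degree_eq_natDegree hq0, hd] at hpq
      exact degree_eq_bot.1 (by simpa using Nat.WithBot.lt_zero_iff.1 hpq)
    rw [eq_C_of_natDegree_eq_zero hd] at hq0 ⊢
    refine ⟨0, Submodule.zero_mem _, 0, fun s _ => by simp [hp], fun s _ => ?_⟩
    simpa using hq0
  | succ d ih =>
    have hq0 : q ≠ 0 := by
      rintro rfl
      simp at hpq
    obtain ⟨a, ha⟩ := IsAlgClosed.exists_root q (by
      rw [degree_eq_natDegree hq0, hd]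
      exact_mod_cast Nat.succ_ne_zero d)
    obtain ⟨r, hqr, hr⟩ := exists_eq_pow_rootMultiplicity_mul_and_not_dvd q hq0 a
    obtain ⟨m, hm⟩ := Nat.exists_eq_succ_of_ne_zero ((rootMultiplicity_pos hq0).2 ha).ne'
    rw [hm] at hqr
    have hra : r.eval a ≠ 0 := fun h => hr (dvd_iff_isRoot.2 h)
    have hr0 : r ≠ 0 := by
      rintro rfl
      simp at hra
    -- With `q = (X - a)^(m+1) r`, this `c` makes `p - c r` vanish at `a`, so `p/q = p'/q' + c/(X -
    -- a)^(m+1)` where `q'` has degree one less than `q`.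
    set c := p.eval a / r.eval a with hc
    obtain ⟨p', hp'⟩ : X - C a ∣ p - C c * r := by
      rw [dvd_iff_isRoot]
      simp [hc, hra]
    set q' := (X - C a) ^ m * r with hq'
    have hqq' : q = (X - C a) * q' := by rw [hqr, hq', Nat.succ_eq_add_one]; ring
    have hrq : r.degree < q.degree := by
      rw [hqr, degree_mul, degree_pow, degree_X_sub_C, degree_eq_natDegree hr0]
      simp only [nsmul_eq_mul, mul_one]
      exact_mod_cast (by omega : r.natDegree < m.succ + r.natDegree)
    have hdeg : p'.degree < q'.degree := by
      have h1 : (p - C c * r).degree < q.degree :=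
        (degree_sub_le _ _).trans_lt (max_lt hpq ((C_mul' c r ▸ degree_smul_le c r).trans_lt hrq))
      rw [hp', hqq', degree_mul, degree_mul, degree_X_sub_C] at h1
      exact lt_of_add_lt_add_left h1
    have hnd : q'.natDegree = d := by
      have hq'0 : q' ≠ 0 := by
        rintro h
        exact hq0 (by rw [hqq', h, mul_zero])
      have := congrArg natDegree hqq'
      rw [natDegree_mul (X_sub_C_ne_zero a) hq'0, natDegree_X_sub_C, hd] at this
      omega
    obtain ⟨y, hy, σ, hL, hne⟩ := ih p' q' (fun z hz => hS z (by
      rw [hqq', IsRoot, eval_mul, hz.eq_zero, mul_zero])) hdeg hnd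
    have hne' : ∀ s : ℂ, max σ a.re < s.re → s - a ≠ 0 ∧ q'.eval s ≠ 0 := by
      intro s hs
      refine ⟨fun h => ?_, hne s ((le_max_left _ _).trans_lt hs)⟩
      rw [sub_eq_zero] at h
      exact ((le_max_right σ a.re).trans_lt hs).ne (by rw [h])
    have hqs : ∀ s, q.eval s = (s - a) * q'.eval s := fun s => by rw [hqq']; simp
    -- Division by `m!` because `t^m e^(at)` has transform `m!/(s - a)^(m+1)`.
    refine ⟨y + (c / m.factorial) • fun t : ℝ => (t : ℂ) ^ m * Complex.exp (a * t),
      (expPoly S).add_mem hy ((expPoly S).smul_mem _ (expPoly_generator_mem (hS a ha) m)),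
      max σ a.re, ?_, fun s hs => ?_⟩
    · refine ((hL.mono (le_max_left _ _)).add
        (((hasLaplaceOn_pow_mul_exp a m).mono (le_max_right _ _)).const_smul _)).congr fun s hs => ?_
      obtain ⟨h1, h2⟩ := hne' s hs
      have hq's : q'.eval s = (s - a) ^ m * r.eval s := by simp [hq']
      have hrs : r.eval s ≠ 0 := by
        intro h
        rw [hq's, h, mul_zero] at h2
        exact h2 rfl
      have hps : p.eval s = (s - a) * p'.eval s + c * r.eval s := by
        have := congrArg (eval s) hp'
        simp only [eval_sub, eval_mul, eval_C, eval_X] at this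
        linear_combination this
      have hf : (m.factorial : ℂ) ≠ 0 := by exact_mod_cast m.factorial_ne_zero
      simp only [Pi.add_apply, Pi.smul_apply, smul_eq_mul]
      rw [hqs, hps, hq's]
      field_simp
      ring
    · rw [hqs]
      exact mul_ne_zero (hne' s hs).1 (hne' s hs).2

theorem evalC_conj (f : RatFunc ℝ) (s : ℂ) :
    evalC f (starRingEnd ℂ s) = starRingEnd ℂ (evalC f s) := by
  have h : ∀ p : ℝ[X], aeval (starRingEnd ℂ s) p = starRingEnd ℂ (aeval s p) := fun p =>
    (aeval_algHom_apply Complex.conjAe.toAlgHom s p)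
  rw [evalC_eq_div, evalC_eq_div, h, h, map_div₀]

/-- A strictly proper real rational function with poles in `S` is the Laplace transform of the real
part of an exponential polynomial with exponents in `S`. -/
theorem exists_expPoly_hasLaplaceTransform (S : Set ℂ) {f : RatFunc ℝ}
    (hf : f.num.degree < f.denom.degree) (hS : ∀ z : ℂ, aeval z f.denom = 0 → z ∈ S) :
    ∃ y ∈ expPoly S, HasLaplaceTransform (fun t => (y t).re) f := by
  obtain ⟨y, hy, σ, hL, -⟩ := exists_expPoly_hasLaplaceOn S
    (f.num.map (algebraMap ℝ ℂ)) (f.denom.map (algebraMap ℝ ℂ))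
    (fun z hz => hS z (by rwa [IsRoot, eval_map_algebraMap] at hz)) (by simpa using hf)
  have hL1 : HasLaplaceOn y σ (evalC f) := hL.congr fun s _ => by
    rw [evalC_eq_div, eval_map_algebraMap, eval_map_algebraMap]
  -- Since `f` has real coefficients, the conjugate of `y` has the same transform; averaging the two
  -- leaves the real part.
  have hL2 : HasLaplaceOn (fun t => starRingEnd ℂ (y t)) σ (evalC f) := by
    intro s hs
    obtain ⟨h1, h2⟩ := hL1 (starRingEnd ℂ s) (by simpa using hs)
    have he : (fun t : ℝ => Complex.exp (-(s * t)) * starRingEnd ℂ (y t)) =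
        fun t : ℝ => starRingEnd ℂ (Complex.exp (-(starRingEnd ℂ s * t)) * y t) := by
      funext t
      rw [map_mul, ← Complex.exp_conj]
      simp
    rw [he]
    refine ⟨?_, ?_⟩
    · exact (Complex.conjLIE.toContinuousLinearEquiv.toContinuousLinearMap.integrable_comp h1)
    · rw [integral_conj, h2, evalC_conj, Complex.conj_conj]
  refine ⟨y, hy, σ, ?_⟩
  have h := ((hL1.add hL2).const_smul (1 / 2)).congr (H := evalC f) fun s _ => by
    simp only [Pi.smul_apply, Pi.add_apply, smul_eq_mul]
    ring
  have he : ((1 / 2 : ℂ) • (y + fun t => starRingEnd ℂ (y t))) = fun t => (((y t).re : ℝ) : ℂ) := by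
    funext t
    simp only [Pi.smul_apply, Pi.add_apply, smul_eq_mul, Complex.add_conj]
    push_cast
    ring
  rwa [he] at h

/-! ### Uniqueness of the inverse Laplace transform -/

/-- On the line `Re s = σ + 1` the Laplace transform is the Fourier transform of `e^(-(σ+1)t) y(t)`
cut off to `t > 0`, the frequency `w` corresponding to `s = σ + 1 + 2πiw`. Fourier inversion at a
point of continuity gives the value `0`. -/
theorem HasLaplaceOn.eq_zero {y : ℝ → ℂ} {σ : ℝ} (hc : ContinuousOn y (Set.Ioi 0))
    (h : HasLaplaceOn y σ 0) {t : ℝ} (ht : 0 < t) : y t = 0 := by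
  set h₁ : ℝ → ℂ := fun t => Complex.exp (-(((σ + 1 : ℝ) : ℂ) * t)) * y t with hh₁
  set g : ℝ → ℂ := (Set.Ioi 0).indicator h₁ with hg
  have hint : Integrable g :=
    (integrable_indicator_iff measurableSet_Ioi).2 (h ((σ + 1 : ℝ) : ℂ) (by simp)).1
  have hF : FourierTransform.fourier g = 0 := by
    funext w
    rw [Real.fourier_eq']
    have e1 : (fun v : ℝ => Complex.exp (↑(-2 * Real.pi * inner ℝ v w) * Complex.I) • g v) =
        (Set.Ioi 0).indicator fun v : ℝ =>
          Complex.exp (-((((σ + 1 : ℝ) : ℂ) + 2 * Real.pi * w * Complex.I) * v)) * y v := by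
      funext v
      by_cases hv : v ∈ Set.Ioi (0 : ℝ)
      · rw [hg, Set.indicator_of_mem hv, Set.indicator_of_mem hv, hh₁, smul_eq_mul, ← mul_assoc,
          ← Complex.exp_add]
        congr 2
        simp only [Real.inner_apply]
        push_cast
        ring
      · rw [hg, Set.indicator_of_notMem hv, Set.indicator_of_notMem hv, smul_zero]
    rw [e1, integral_indicator measurableSet_Ioi]
    exact (h _ (by simp)).2
  have hcont : ContinuousAt g t := by
    have h1 : ContinuousAt h₁ t :=
      (Continuous.continuousAt (by fun_prop)).mul (hc.continuousAt (Ioi_mem_nhds ht))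
    refine h1.congr ?_
    filter_upwards [Ioi_mem_nhds ht] with v hv
    rw [hg, Set.indicator_of_mem hv]
  have hinv := hint.fourierInv_fourier_eq (by rw [hF]; exact integrable_zero _ _ _) hcont
  rw [hF, hg, Set.indicator_of_mem (Set.mem_Ioi.2 ht), hh₁] at hinv
  have h0 : FourierTransformInv.fourierInv (0 : ℝ → ℂ) t = 0 := by
    rw [Real.fourierInv_eq']
    simp
  rw [h0] at hinv
  exact (mul_eq_zero.1 hinv.symm).resolve_left (Complex.exp_ne_zero _)

theorem HasLaplaceTransform.eqOn {x y : ℝ → ℝ} {F : RatFunc ℝ} (hx : HasLaplaceTransform x F)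
    (hy : HasLaplaceTransform y F) (hcx : ContinuousOn x (Set.Ioi 0))
    (hcy : ContinuousOn y (Set.Ioi 0)) : Set.EqOn x y (Set.Ioi 0) := by
  obtain ⟨σ, hx⟩ := hx
  obtain ⟨τ, hy⟩ := hy
  have hx' : HasLaplaceOn (fun t => (x t : ℂ)) σ (evalC F) := hx
  have hy' : HasLaplaceOn (fun t => (y t : ℂ)) τ (evalC F) := hy
  have h := (hx'.mono (le_max_left σ τ)).sub (hy'.mono (le_max_right σ τ))
  rw [sub_self] at h
  intro t ht
  have h0 := h.eq_zero ((Complex.continuous_ofReal.comp_continuousOn hcx).sub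
    (Complex.continuous_ofReal.comp_continuousOn hcy)) ht
  simpa [sub_eq_zero] using h0

theorem HasLaplaceTransform.sub {x y : ℝ → ℝ} {F G : RatFunc ℝ} (hx : HasLaplaceTransform x F)
    (hy : HasLaplaceTransform y G) : HasLaplaceTransform (fun t => x t - y t) (F - G) := by
  obtain ⟨σ, hx⟩ := hx
  obtain ⟨τ, hy⟩ := hy
  have hx' : HasLaplaceOn (fun t => (x t : ℂ)) σ (evalC F) := hx
  have hy' : HasLaplaceOn (fun t => (y t : ℂ)) τ (evalC G) := hy
  have hfin := eventually_cofinite.1 (eventually_evalC_sub F G)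
  -- The finitely many points where evaluation fails to respect subtraction are avoided by moving
  -- the half plane to their right.
  obtain ⟨ρ, hρ⟩ := (hfin.image Complex.re).bddAbove
  have h := ((hx'.mono (le_max_left σ τ)).sub (hy'.mono (le_max_right σ τ))).mono
    (le_max_left _ ρ)
  refine ⟨max (max σ τ) ρ, ?_⟩
  have h2 := h.congr (H := evalC (F - G)) fun s hs => by
    by_contra hne
    exact absurd (hρ ⟨s, fun h => hne h.symm, rfl⟩) (not_le.2 ((le_max_right _ ρ).trans_lt hs))
  have he : ((fun t => (x t : ℂ)) - fun t => (y t : ℂ)) = fun t => ((x t - y t : ℝ) : ℂ) := by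
    funext t
    simp
  rwa [he] at h2

/-! ### The spectrum of a symmetric graph Laplacian -/

section Laplacian

variable {ι : Type*} [Fintype ι] [DecidableEq ι]

theorem graphLaplacian_offDiag_symm {W : Matrix ι ι ℝ}
    (hsymm : graphLaplacian W = (graphLaplacian W).transpose) {i j : ι} (hij : i ≠ j) :
    W i j = W j i := by
  have := congrFun (congrFun hsymm i) j
  simpa [graphLaplacian, hij, hij.symm] using this

theorem isHermitian_graphLaplacian {W : Matrix ι ι ℝ}
    (hsymm : graphLaplacian W = (graphLaplacian W).transpose) :
    ((graphLaplacian W).map Complex.ofReal).IsHermitian := by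
  ext i j
  have := congrFun (congrFun hsymm i) j
  simp only [Matrix.conjTranspose_apply, Matrix.map_apply, Complex.star_def, Complex.conj_ofReal]
  rw [this, Matrix.transpose_apply]

theorem graphLaplacian_mulVec (W : Matrix ι ι ℝ) (v : ι → ℂ) (i : ι) :
    ((graphLaplacian W).map Complex.ofReal).mulVec v i = ∑ j, (W i j : ℂ) * (v i - v j) := by
  simp only [Matrix.mulVec, dotProduct, Matrix.map_apply]
  rw [← Finset.add_sum_erase _ _ (Finset.mem_univ i),
    ← Finset.add_sum_erase _ (fun j => (W i j : ℂ) * (v i - v j)) (Finset.mem_univ i)]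
  simp only [graphLaplacian, Matrix.of_apply, if_true, sub_self, mul_zero, zero_add]
  push_cast
  rw [Finset.sum_mul, ← Finset.sum_add_distrib]
  refine Finset.sum_congr rfl fun j hj => ?_
  rw [if_neg (Finset.ne_of_mem_erase hj).symm]
  push_cast
  ring

/-- Swapping the summation indices and adding the two copies of the sum symmetrizes it. Symmetry of
`L` says nothing about the diagonal of `W`, but diagonal terms carry `v i - v i = 0`. -/
theorem two_mul_energy_graphLaplacian {W : Matrix ι ι ℝ}
    (hsymm : graphLaplacian W = (graphLaplacian W).transpose) (v : ι → ℂ) :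
    2 * ∑ i, starRingEnd ℂ (v i) * ((graphLaplacian W).map Complex.ofReal).mulVec v i =
      ((∑ i, ∑ j, W i j * ‖v i - v j‖ ^ 2 : ℝ) : ℂ) := by
  have h0 : ∑ i, starRingEnd ℂ (v i) * ((graphLaplacian W).map Complex.ofReal).mulVec v i =
      ∑ i, ∑ j, starRingEnd ℂ (v i) * ((W i j : ℂ) * (v i - v j)) :=
    Finset.sum_congr rfl fun i _ => by rw [graphLaplacian_mulVec, Finset.mul_sum]
  have h1 : ∑ i, ∑ j, starRingEnd ℂ (v i) * ((W i j : ℂ) * (v i - v j)) =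
      ∑ i, ∑ j, starRingEnd ℂ (v j) * ((W i j : ℂ) * (v j - v i)) := by
    rw [Finset.sum_comm]
    refine Finset.sum_congr rfl fun i _ => Finset.sum_congr rfl fun j _ => ?_
    by_cases hij : i = j
    · simp [hij]
    · rw [graphLaplacian_offDiag_symm hsymm hij]
  rw [h0, two_mul]
  nth_rewrite 2 [h1]
  rw [← Finset.sum_add_distrib, Complex.ofReal_sum]
  refine Finset.sum_congr rfl fun i _ => ?_
  rw [← Finset.sum_add_distrib, Complex.ofReal_sum]
  refine Finset.sum_congr rfl fun j _ => ?_
  push_cast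
  rw [← Complex.conj_mul', map_sub]
  ring

/-- The energy identity equates `2r‖v‖²` with a sum of nonnegative terms. If `r = 0`, every term
vanishes, so `v` agrees across each edge, and hence along the directed paths from the root. -/
theorem eigenvalue_nonneg_and_const {W : Matrix ι ι ℝ} (hW : ∀ i j, 0 ≤ W i j)
    (htree : HasConnectedSpanningTree W)
    (hsymm : graphLaplacian W = (graphLaplacian W).transpose) {v : ι → ℂ} {r : ℝ} (hv : v ≠ 0)
    (h : ((graphLaplacian W).map Complex.ofReal).mulVec v = (r : ℂ) • v) :
    0 ≤ r ∧ (r = 0 → ∀ i j, v i = v j) := by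
  have hE : 2 * (r * ∑ i, ‖v i‖ ^ 2) = ∑ i, ∑ j, W i j * ‖v i - v j‖ ^ 2 := by
    have := two_mul_energy_graphLaplacian hsymm v
    rw [h] at this
    rw [← Complex.ofReal_inj, ← this]
    push_cast
    congr 1
    rw [Finset.mul_sum]
    refine Finset.sum_congr rfl fun i _ => ?_
    rw [Pi.smul_apply, smul_eq_mul, ← Complex.conj_mul']
    ring
  have hterm : ∀ i j, 0 ≤ W i j * ‖v i - v j‖ ^ 2 := fun i j => mul_nonneg (hW i j) (sq_nonneg _)
  have hpos : 0 < ∑ i, ‖v i‖ ^ 2 := by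
    obtain ⟨i, hi⟩ := Function.ne_iff.1 hv
    exact Finset.sum_pos' (fun i _ => sq_nonneg _) ⟨i, Finset.mem_univ i, by
      have : 0 < ‖v i‖ := norm_pos_iff.2 hi
      positivity⟩
  refine ⟨?_, ?_⟩
  · by_contra hr
    have h1 : 0 ≤ ∑ i, ∑ j, W i j * ‖v i - v j‖ ^ 2 :=
      Finset.sum_nonneg fun i _ => Finset.sum_nonneg fun j _ => hterm i j
    nlinarith [mul_pos (neg_pos.2 (not_le.1 hr)) hpos]
  · rintro rfl
    have h0 : ∀ i j, W i j * ‖v i - v j‖ ^ 2 = 0 := by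
      rw [zero_mul, mul_zero] at hE
      intro i j
      have h1 := (Finset.sum_eq_zero_iff_of_nonneg
        fun i _ => Finset.sum_nonneg fun j _ => hterm i j).1 hE.symm i (Finset.mem_univ i)
      exact (Finset.sum_eq_zero_iff_of_nonneg fun j _ => hterm i j).1 h1 j (Finset.mem_univ j)
    obtain ⟨root, hroot⟩ := htree
    have hc : ∀ j, v j = v root := by
      intro j
      induction hroot j with
      | refl => rfl
      | tail _ hbc ih =>
        rename_i b c _
        have h1 := (mul_eq_zero.1 (h0 c b)).resolve_left (ne_of_gt hbc)
        rw [sq_eq_zero_iff, norm_eq_zero, sub_eq_zero] at h1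
        rw [h1, ih]
    intro i j
    rw [hc i, hc j]

end Laplacian

/-! ### Functional calculus in an orthonormal eigenbasis -/

section Eigenbasis

variable {ι : Type*} [Fintype ι] [DecidableEq ι] {A : Matrix ι ι ℂ} (hA : A.IsHermitian)

theorem inner_eigenvectorBasis_mulVec (m : ι) (x : ι → ℂ) :
    inner ℂ (hA.eigenvectorBasis m) (WithLp.toLp 2 (A.mulVec x)) =
      hA.eigenvalues m * inner ℂ (hA.eigenvectorBasis m) (WithLp.toLp 2 x) := by
  have hs := (Matrix.isSymmetric_toEuclideanLin_iff.2 hA) (hA.eigenvectorBasis m) (WithLp.toLp 2 x)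
  have h1 : Matrix.toEuclideanLin A (hA.eigenvectorBasis m) =
      (hA.eigenvalues m : ℂ) • hA.eigenvectorBasis m := by
    ext i
    have := congrFun (hA.mulVec_eigenvectorBasis m) i
    simpa using this
  rw [h1, inner_smul_left, Complex.conj_ofReal] at hs
  exact hs.symm

/-- Working with coordinates of `(sI + A)^n x` itself avoids inverting `sI + A`. -/
theorem inner_eigenvectorBasis_add_pow_mulVec (s : ℂ) (n : ℕ) (m : ι) (x : ι → ℂ) :
    inner ℂ (hA.eigenvectorBasis m) (WithLp.toLp 2 (((s • (1 : Matrix ι ι ℂ) + A) ^ n).mulVec x)) =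
      (s + hA.eigenvalues m) ^ n * inner ℂ (hA.eigenvectorBasis m) (WithLp.toLp 2 x) := by
  induction n generalizing x with
  | zero => simp
  | succ n ih =>
    rw [pow_succ, ← Matrix.mulVec_mulVec, ih, Matrix.add_mulVec, Matrix.smul_mulVec,
      Matrix.one_mulVec, WithLp.toLp_add, WithLp.toLp_smul, inner_add_right, inner_smul_right,
      inner_eigenvectorBasis_mulVec]
    ring

theorem inner_eigenvectorBasis_smul_pow_mulVec (c : ℂ) (n : ℕ) (m : ι) (x : ι → ℂ) :
    inner ℂ (hA.eigenvectorBasis m) (WithLp.toLp 2 ((c • A ^ n).mulVec x)) =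
      c * (hA.eigenvalues m : ℂ) ^ n * inner ℂ (hA.eigenvectorBasis m) (WithLp.toLp 2 x) := by
  rw [Matrix.smul_mulVec, WithLp.toLp_smul, inner_smul_right, mul_assoc]
  congr 1
  have := inner_eigenvectorBasis_add_pow_mulVec hA 0 n m x
  simpa using this

omit [DecidableEq ι] in
theorem norm_le_mul_norm_of_inner_le {x y : EuclideanSpace ℂ ι} {c : ℝ} (hc : 0 ≤ c)
    (b : OrthonormalBasis ι ℂ (EuclideanSpace ℂ ι))
    (h : ∀ m, ‖(inner ℂ (b m) x : ℂ)‖ ≤ c * ‖(inner ℂ (b m) y : ℂ)‖) : ‖x‖ ≤ c * ‖y‖ := by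
  refine le_of_sq_le_sq ?_ (by positivity)
  rw [mul_pow, ← b.sum_sq_norm_inner_right x, ← b.sum_sq_norm_inner_right y, Finset.mul_sum]
  refine Finset.sum_le_sum fun m _ => ?_
  rw [← mul_pow]
  exact pow_le_pow_left₀ (norm_nonneg _) (h m) 2

end Eigenbasis

/-! ### The scalar estimate -/

/-- The gain of `s ^ k λ ^ (n - k) / (s + λ) ^ n` over the right half plane. -/
noncomputable def gain (n k : ℕ) : ℝ :=
  Real.sqrt ((k : ℝ) ^ k / (n : ℝ) ^ n * ((n : ℝ) - k) ^ (n - k))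

theorem gain_nonneg (n k : ℕ) : 0 ≤ gain n k := Real.sqrt_nonneg _

/-- Weighted AM-GM for `a/k` and `b/l` with weights `k/(k+l)` and `l/(k+l)`, raised to the power `k
+ l`. The cases `k = 0` and `l = 0` are separate because of the divisions; there `0^0 = 1`. -/
theorem pow_mul_pow_le_gain {k l : ℕ} {a b : ℝ} (ha : 0 ≤ a) (hb : 0 ≤ b) :
    a ^ k * b ^ l ≤ (k : ℝ) ^ k / ((k + l : ℕ) : ℝ) ^ (k + l) * (l : ℝ) ^ l * (a + b) ^ (k + l) := by
  rcases Nat.eq_zero_or_pos k with rfl | hk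
  · rcases Nat.eq_zero_or_pos l with rfl | hl
    · simp
    · have : (0 : ℝ) < (l : ℝ) ^ l := by positivity
      simp only [pow_zero, one_mul, zero_add]
      rw [one_div, inv_mul_cancel₀ this.ne', one_mul]
      exact pow_le_pow_left₀ hb (by linarith) l
  rcases Nat.eq_zero_or_pos l with rfl | hl
  · have : (0 : ℝ) < (k : ℝ) ^ k := by positivity
    simp only [pow_zero, mul_one, add_zero]
    rw [div_self this.ne', one_mul]
    exact pow_le_pow_left₀ ha (by linarith) k
  have hk' : (0 : ℝ) < k := by exact_mod_cast hk
  have hl' : (0 : ℝ) < l := by exact_mod_cast hl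
  have hn : (0 : ℝ) < k + l := by positivity
  have hn0 : k + l ≠ 0 := by omega
  have h := Real.geom_mean_le_arith_mean2_weighted (w₁ := k / (k + l)) (w₂ := l / (k + l))
    (p₁ := a / k) (p₂ := b / l) (by positivity) (by positivity) (by positivity) (by positivity)
    (by field_simp)
  have h2 := pow_le_pow_left₀ (by positivity) h (k + l)
  have e1 : ((a / k) ^ ((k : ℝ) / (k + l)) * (b / l) ^ ((l : ℝ) / (k + l))) ^ (k + l) =
      (a / k) ^ k * (b / l) ^ l := by
    rw [mul_pow, ← Real.rpow_mul_natCast (by positivity), ← Real.rpow_mul_natCast (by positivity)]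
    push_cast
    rw [div_mul_cancel₀ _ hn.ne', div_mul_cancel₀ _ hn.ne', Real.rpow_natCast, Real.rpow_natCast]
  have e2 : (k : ℝ) / (k + l) * (a / k) + (l : ℝ) / (k + l) * (b / l) = (a + b) / (k + l) := by
    field_simp
  rw [e1, e2, div_pow, div_pow, div_pow, div_mul_div_comm, div_le_div_iff₀ (by positivity)
    (by positivity)] at h2
  push_cast
  rw [div_mul_eq_mul_div, div_mul_eq_mul_div, le_div_iff₀ (by positivity)]
  linarith

theorem norm_pow_mul_pow_le_gain {n k : ℕ} (hk : k ≤ n) {s : ℂ} (hs : 0 < s.re) {r : ℝ}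
    (hr : 0 ≤ r) : ‖s ^ k * (r : ℂ) ^ (n - k)‖ ≤ gain n k * ‖(s + r) ^ n‖ := by
  -- Compare squares: the cross term `2 r Re s` in `|s + r|²` is nonnegative, and AM-GM applies to
  -- `|s|²` and `r²`.
  obtain ⟨l, rfl⟩ := Nat.exists_eq_add_of_le hk
  rw [Nat.add_sub_cancel_left]
  have h1 : ‖s‖ ^ 2 + r ^ 2 ≤ ‖s + r‖ ^ 2 := by
    rw [Complex.sq_norm, Complex.sq_norm, Complex.normSq_apply, Complex.normSq_apply]
    simp only [Complex.add_re, Complex.ofReal_re, Complex.add_im, Complex.ofReal_im, add_zero]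
    nlinarith [mul_nonneg hs.le hr]
  refine le_of_sq_le_sq ?_ (by unfold gain; positivity)
  have h2 := pow_mul_pow_le_gain (k := k) (l := l) (sq_nonneg ‖s‖) (sq_nonneg r)
  have hc : 0 ≤ (k : ℝ) ^ k / ((k + l : ℕ) : ℝ) ^ (k + l) * (l : ℝ) ^ l := by positivity
  have hgain : gain (k + l) k ^ 2 = (k : ℝ) ^ k / ((k + l : ℕ) : ℝ) ^ (k + l) * (l : ℝ) ^ l := by
    unfold gain
    have : ((k + l : ℕ) : ℝ) - k = l := by push_cast; ring
    rw [this, Nat.add_sub_cancel_left, Real.sq_sqrt hc]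
  rw [mul_pow, hgain, norm_mul, norm_pow, norm_pow, norm_pow, mul_pow, Complex.norm_real,
    pow_right_comm ‖s‖ k 2, pow_right_comm ‖r‖ l 2, pow_right_comm ‖s + (r : ℂ)‖ _ 2,
    Real.norm_eq_abs, sq_abs]
  exact h2.trans (mul_le_mul_of_nonneg_left (pow_le_pow_left₀ (by positivity) h1 _) hc)

theorem gain_zero {n : ℕ} (hn : 1 ≤ n) : gain n 0 = 1 := by
  have : (0 : ℝ) < (n : ℝ) ^ n := by positivity
  simp [gain, this.ne']

theorem gain_self {n : ℕ} (hn : 1 ≤ n) : gain n n = 1 := by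
  have : (0 : ℝ) < (n : ℝ) ^ n := by positivity
  simp [gain, this.ne']

theorem sum_hInfNorm_mul_gain {ι : Type*} [Fintype ι] [DecidableEq ι] {n : ℕ} (hn : 1 ≤ n)
    (Δ : ℕ → Matrix ι ι (RatFunc ℝ)) :
    ∑ k ∈ Finset.range (n + 1), hInfNorm (Δ k) * ENNReal.ofReal (gain n k) =
      hInfNorm (Δ 0) + hInfNorm (Δ n) +
        ∑ k ∈ Finset.Ioo 0 n, hInfNorm (Δ k) * ENNReal.ofReal (gain n k) := by
  have h : Finset.range (n + 1) = insert 0 (insert n (Finset.Ioo 0 n)) := by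
    ext k
    simp only [Finset.mem_range, Finset.mem_insert, Finset.mem_Ioo]
    omega
  rw [h, Finset.sum_insert (by simp; omega), Finset.sum_insert (by simp), gain_zero hn,
    gain_self hn, ENNReal.ofReal_one, mul_one, mul_one, add_assoc]

/-! ### Small-gain estimate for the evaluated system -/

section SmallGain

variable {ι : Type*} [Fintype ι] [DecidableEq ι] {A : Matrix ι ι ℂ} (hA : A.IsHermitian)

include hA in
theorem norm_smul_pow_mulVec_le_gain (hpos : ∀ m, 0 ≤ hA.eigenvalues m) {n k : ℕ} (hk : k ≤ n)
    {s : ℂ} (hs : 0 < s.re) (x : ι → ℂ) :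
    ‖WithLp.toLp 2 ((s ^ k • A ^ (n - k)).mulVec x)‖ ≤
      gain n k * ‖WithLp.toLp 2 (((s • (1 : Matrix ι ι ℂ) + A) ^ n).mulVec x)‖ := by
  refine norm_le_mul_norm_of_inner_le (gain_nonneg n k) hA.eigenvectorBasis fun m => ?_
  rw [inner_eigenvectorBasis_smul_pow_mulVec, inner_eigenvectorBasis_add_pow_mulVec, norm_mul,
    norm_mul _ (inner ℂ _ _), ← mul_assoc]
  exact mul_le_mul_of_nonneg_right (norm_pow_mul_pow_le_gain hk hs (hpos m)) (norm_nonneg _)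

include hA in
theorem exists_norm_sub_le (hpos : ∀ m, 0 ≤ hA.eigenvalues m)
    (hker : ∀ m, hA.eigenvalues m = 0 → ∀ i j,
      hA.eigenvectorBasis m i = hA.eigenvectorBasis m j) {n : ℕ} (hn : 1 ≤ n) (i j : ι) :
    ∃ C : ℝ, 0 ≤ C ∧ ∀ s : ℂ, 0 < s.re → ∀ x : ι → ℂ,
      ‖x i - x j‖ ≤ C * ‖WithLp.toLp 2 (((s • (1 : Matrix ι ι ℂ) + A) ^ n).mulVec x)‖ := by
  set b := hA.eigenvectorBasis with hb
  -- A zero eigenvalue contributes nothing: its eigenvector is constant, so the numerator is `0`.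
  -- For the others, `λ^n ≤ |s + λ|^n` is the gain estimate with `k = 0`.
  refine ⟨∑ m, ‖b m i - b m j‖ / hA.eigenvalues m ^ n, Finset.sum_nonneg fun m _ =>
    div_nonneg (norm_nonneg _) (pow_nonneg (hpos m) n), fun s hs x => ?_⟩
  have hx : x i - x j = ∑ m, inner ℂ (b m) (WithLp.toLp 2 x) * (b m i - b m j) := by
    have h := b.sum_repr' (WithLp.toLp 2 x)
    have h1 : ∀ l, x l = ∑ m, inner ℂ (b m) (WithLp.toLp 2 x) * b m l := fun l => by
      have := congrArg (fun y : EuclideanSpace ℂ ι => y l) h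
      simpa using this.symm
    rw [h1 i, h1 j, ← Finset.sum_sub_distrib]
    exact Finset.sum_congr rfl fun m _ => by rw [mul_sub]
  rw [hx, Finset.sum_mul]
  refine (norm_sum_le _ _).trans (Finset.sum_le_sum fun m _ => ?_)
  rcases (hpos m).eq_or_lt with h0 | h0
  · rw [hker m h0.symm i j]
    simp
  · have h1 := norm_pow_mul_pow_le_gain (Nat.zero_le n) hs (hpos m)
    rw [gain_zero hn, pow_zero, one_mul, one_mul, Nat.sub_zero, norm_pow, Complex.norm_real,
      Real.norm_of_nonneg h0.le] at h1
    have h2 := norm_inner_le_norm (𝕜 := ℂ) (b m)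
      (WithLp.toLp 2 (((s • (1 : Matrix ι ι ℂ) + A) ^ n).mulVec x))
    rw [b.norm_eq_one, one_mul, hb, inner_eigenvectorBasis_add_pow_mulVec, norm_mul] at h2
    have h3 := (mul_le_mul_of_nonneg_right h1 (norm_nonneg _)).trans h2
    rw [norm_mul, div_mul_eq_mul_div, le_div_iff₀ (pow_pos h0 n)]
    calc _ = ‖b m i - b m j‖ * (hA.eigenvalues m ^ n * ‖inner ℂ (b m) (WithLp.toLp 2 x)‖) := by ring
      _ ≤ _ := mul_le_mul_of_nonneg_left h3 (norm_nonneg _)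

include hA in
-- The bounds `d k` are extended reals because an `H∞` norm may be infinite a priori; the vector
-- norms are finite, which later allows the last term to be absorbed on the left.
theorem enorm_le_of_perturbed (hpos : ∀ m, 0 ≤ hA.eigenvalues m) {n : ℕ} {s : ℂ}
    (hs : 0 < s.re) {x u : ι → ℂ} {D : ℕ → Matrix ι ι ℂ} {d : ℕ → ℝ≥0∞}
    (hD : ∀ k, ‖Matrix.toEuclideanCLM (n := ι) (𝕜 := ℂ) (D k)‖ₑ ≤ d k)
    (h : ((s • (1 : Matrix ι ι ℂ) + A) ^ n).mulVec x =
      u + ∑ k ∈ Finset.range (n + 1), (D k).mulVec ((s ^ k • A ^ (n - k)).mulVec x)) :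
    ‖WithLp.toLp 2 (((s • (1 : Matrix ι ι ℂ) + A) ^ n).mulVec x)‖ₑ ≤ ‖WithLp.toLp 2 u‖ₑ +
      (∑ k ∈ Finset.range (n + 1), d k * ENNReal.ofReal (gain n k)) *
        ‖WithLp.toLp 2 (((s • (1 : Matrix ι ι ℂ) + A) ^ n).mulVec x)‖ₑ := by
  set Z := ((s • (1 : Matrix ι ι ℂ) + A) ^ n).mulVec x with hZ
  conv_lhs => rw [h]
  rw [WithLp.toLp_add, WithLp.toLp_sum, Finset.sum_mul]
  refine (enorm_add_le _ _).trans (add_le_add_right ((enorm_sum_le _ _).trans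
    (Finset.sum_le_sum fun k hk => ?_)) _)
  rw [← Matrix.toEuclideanCLM_toLp]
  refine (ContinuousLinearMap.le_opENorm _ _).trans ?_
  rw [mul_assoc]
  refine mul_le_mul' (hD k) ?_
  rw [← ofReal_norm, ← ofReal_norm, ← ENNReal.ofReal_mul (gain_nonneg n k)]
  exact ENNReal.ofReal_le_ofReal (norm_smul_pow_mulVec_le_gain hA hpos
    (Nat.lt_succ_iff.1 (Finset.mem_range.1 hk)) hs x)

theorem le_mul_of_enorm_le {E F : Type*} [NormedAddCommGroup E] [NormedAddCommGroup F]
    {z : E} {u : F} {ρ : ℝ≥0∞} (hρ : ρ < 1) (h : ‖z‖ₑ ≤ ‖u‖ₑ + ρ * ‖z‖ₑ) :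
    ‖z‖ ≤ (1 - ρ.toReal)⁻¹ * ‖u‖ := by
  have hρ' : ρ.toReal < 1 := by
    simpa using (ENNReal.toReal_lt_toReal (hρ.trans ENNReal.one_lt_top).ne ENNReal.one_ne_top).2 hρ
  have hfin : ‖u‖ₑ + ρ * ‖z‖ₑ ≠ ∞ :=
    ENNReal.add_ne_top.2 ⟨enorm_ne_top, ENNReal.mul_ne_top hρ.ne_top enorm_ne_top⟩
  have h1 := ENNReal.toReal_mono hfin h
  rw [ENNReal.toReal_add enorm_ne_top (ENNReal.mul_ne_top hρ.ne_top enorm_ne_top),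
    ENNReal.toReal_mul, toReal_enorm, toReal_enorm] at h1
  rw [inv_mul_eq_div, le_div_iff₀ (by linarith)]
  linarith

end SmallGain

/-! ### Solutions of the perturbed system -/

section System

variable {ι : Type*} [Fintype ι] [DecidableEq ι]

theorem enorm_evalMatrix_le_hInfNorm (G : Matrix ι ι (RatFunc ℝ)) {s : ℂ} (hs : 0 < s.re) :
    ‖Matrix.toEuclideanCLM (n := ι) (𝕜 := ℂ) (evalMatrix G s)‖ₑ ≤ hInfNorm G :=
  le_iSup₂_of_le s hs le_rfl

/-- Along the right half plane a solution is bounded by the reference, with decay `|s| ^ (-n)`, and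
its differences are bounded by the reference uniformly. -/
theorem exists_bounds_of_isPerturbedSolution {n : ℕ} (hn : 1 ≤ n) {W : Matrix ι ι ℝ}
    (hW : ∀ i j, 0 ≤ W i j) (htree : HasConnectedSpanningTree W)
    (hsymm : graphLaplacian W = (graphLaplacian W).transpose)
    {Δ : ℕ → Matrix ι ι (RatFunc ℝ)}
    (hsmall : ∑ k ∈ Finset.range (n + 1), hInfNorm (Δ k) * ENNReal.ofReal (gain n k) < 1)
    {U X : ι → RatFunc ℝ} (h : IsPerturbedSolution n (graphLaplacian W) Δ U X) (i j : ι) :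
    ∃ C : ℝ, ∀ᶠ s in cofinite, 0 < s.re →
      ‖evalC (X i) s‖ ≤ C * ‖WithLp.toLp 2 fun l => evalC (U l) s‖ / ‖s‖ ^ n ∧
      ‖evalC (X i) s - evalC (X j) s‖ ≤ C * ‖WithLp.toLp 2 fun l => evalC (U l) s‖ := by
  have hA := isHermitian_graphLaplacian hsymm
  have hev : ∀ m, 0 ≤ hA.eigenvalues m ∧ (hA.eigenvalues m = 0 → ∀ i j,
      hA.eigenvectorBasis m i = hA.eigenvectorBasis m j) := fun m =>
    eigenvalue_nonneg_and_const hW htree hsymm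
      (fun h0 => hA.eigenvectorBasis.orthonormal.ne_zero m (by ext i; exact congrFun h0 i))
      (hA.mulVec_eigenvectorBasis m)
  obtain ⟨C, hC0, hC⟩ := exists_norm_sub_le hA (fun m => (hev m).1) (fun m => (hev m).2) hn i j
  set ρ := ∑ k ∈ Finset.range (n + 1), hInfNorm (Δ k) * ENNReal.ofReal (gain n k) with hρ
  -- The factor `1` serves the decay bound, `C` the bound on differences.
  refine ⟨max 1 C * (1 - ρ.toReal)⁻¹, ?_⟩
  filter_upwards [eventually_eval_isPerturbedSolution h] with s heq hs
  have hZ := le_mul_of_enorm_le hsmall (enorm_le_of_perturbed hA (fun m => (hev m).1) hs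
    (fun k => enorm_evalMatrix_le_hInfNorm (Δ k) hs) heq)
  -- The case `k = n`, where the gain is `1`: `|s|^n ‖X‖ ≤ ‖(sI + L)^n X‖`.
  have hbase := norm_smul_pow_mulVec_le_gain hA (fun m => (hev m).1) le_rfl hs (n := n)
    fun l => evalC (X l) s
  rw [gain_self hn, one_mul, Nat.sub_self, pow_zero, Matrix.smul_mulVec, Matrix.one_mulVec,
    WithLp.toLp_smul, norm_smul, norm_pow] at hbase
  have hdiff := hC s hs fun l => evalC (X l) s
  have hs0 : 0 < ‖s‖ := norm_pos_iff.2 fun h0 => by simp [h0] at hs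
  have hcoord := PiLp.norm_apply_le (WithLp.toLp 2 fun l => evalC (X l) s) i
  rw [mul_assoc (max 1 C)]
  refine ⟨?_, ?_⟩
  · rw [le_div_iff₀ (by positivity)]
    calc ‖evalC (X i) s‖ * ‖s‖ ^ n
        ≤ ‖s‖ ^ n * ‖WithLp.toLp 2 fun l => evalC (X l) s‖ := by
          rw [mul_comm]
          exact mul_le_mul_of_nonneg_left hcoord (by positivity)
      _ ≤ _ := (hbase.trans hZ).trans
          (le_mul_of_one_le_left ((norm_nonneg _).trans hZ) (le_max_left _ _))
  · exact hdiff.trans ((mul_le_mul_of_nonneg_left hZ hC0).trans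
      (mul_le_mul_of_nonneg_right (le_max_right _ _) ((norm_nonneg _).trans hZ)))

/-- The system is a square linear one over the field of rational functions, so injectivity implies
surjectivity. -/
theorem existsUnique_isPerturbedSolution {n : ℕ} {L : Matrix ι ι ℝ}
    {Δ : ℕ → Matrix ι ι (RatFunc ℝ)}
    (hinj : ∀ X, IsPerturbedSolution n L Δ 0 X → X = 0) (U : ι → RatFunc ℝ) :
    ∃! X, IsPerturbedSolution n L Δ U X := by
  set P : Matrix ι ι (RatFunc ℝ) :=
    ((RatFunc.X : RatFunc ℝ) • (1 : Matrix ι ι (RatFunc ℝ)) + L.map RatFunc.C) ^ n -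
      ∑ k ∈ Finset.range (n + 1), Δ k * ((RatFunc.X : RatFunc ℝ) ^ k • L.map RatFunc.C ^ (n - k))
    with hP
  have hiff : ∀ U X, IsPerturbedSolution n L Δ U X ↔ P.mulVec X = U := fun U X => by
    rw [hP, Matrix.sub_mulVec, sub_eq_iff_eq_add]
    rfl
  have hPinj : Function.Injective P.mulVec := fun X Y hXY => by
    have h0 := hinj (X - Y) ((hiff _ _).2 (by rw [Matrix.mulVec_sub, hXY, sub_self]))
    exact sub_eq_zero.1 h0
  have hPsurj : Function.Surjective P.mulVec :=
    Matrix.mulVec_surjective_iff_isUnit.2 (Matrix.mulVec_injective_iff_isUnit.1 hPinj)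
  simp only [hiff]
  exact Function.Bijective.existsUnique ⟨hPinj, hPsurj⟩ U

omit [DecidableEq ι] in
theorem continuousAt_norm_evalC {U : ι → RatFunc ℝ} (hU : ∀ i, IsRHInf (U i)) {s : ℂ}
    (hs : 0 ≤ s.re) : ContinuousAt (fun s => ‖WithLp.toLp 2 fun l => evalC (U l) s‖) s := by
  have h : ContinuousAt (fun s => fun l => evalC (U l) s) s :=
    continuousAt_pi.2 fun l => continuousAt_evalC ((hU l).2 s hs)
  exact ((PiLp.continuous_toLp 2 fun _ : ι => ℂ).continuousAt.comp h).norm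

omit [DecidableEq ι] in
theorem exists_tendsto_norm_evalC {U : ι → RatFunc ℝ} (hU : ∀ i, IsRHInf (U i)) :
    ∃ c, Tendsto (fun t : ℝ => ‖WithLp.toLp 2 fun l => evalC (U l) t‖) atTop (𝓝 c) := by
  choose c hc using fun l => exists_tendsto_evalC (hU l).1
  exact ⟨‖WithLp.toLp 2 c‖, (((PiLp.continuous_toLp 2 fun _ : ι => ℂ).tendsto c).comp
    (tendsto_pi_nhds.2 hc)).norm⟩

/-- Entries of a solution are strictly proper, with poles only in the open left half plane and at
the origin; differences of entries have no pole at the origin. -/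
theorem poles_of_isPerturbedSolution {n : ℕ} (hn : 1 ≤ n) {W : Matrix ι ι ℝ}
    (hW : ∀ i j, 0 ≤ W i j) (htree : HasConnectedSpanningTree W)
    (hsymm : graphLaplacian W = (graphLaplacian W).transpose)
    {Δ : ℕ → Matrix ι ι (RatFunc ℝ)}
    (hsmall : ∑ k ∈ Finset.range (n + 1), hInfNorm (Δ k) * ENNReal.ofReal (gain n k) < 1)
    {U X : ι → RatFunc ℝ} (hU : ∀ i, IsRHInf (U i))
    (h : IsPerturbedSolution n (graphLaplacian W) Δ U X) (i j : ι) :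
    (X i).num.degree < (X i).denom.degree ∧
    (X i - X j).num.degree < (X i - X j).denom.degree ∧
    ∀ z : ℂ, aeval z (X i - X j).denom = 0 → z.re < 0 := by
  obtain ⟨c, hc⟩ := exists_tendsto_norm_evalC hU
  have hdecay : ∀ C : ℝ,
      Tendsto (fun t : ℝ => C * ‖WithLp.toLp 2 fun l => evalC (U l) t‖ / ‖(t : ℂ)‖ ^ n) atTop
        (𝓝 0) := fun C =>
    (hc.const_mul C).div_atTop ((tendsto_pow_atTop (by omega)).comp (by
      simpa using tendsto_abs_atTop_atTop))
  obtain ⟨C, hC⟩ := exists_bounds_of_isPerturbedSolution hn hW htree hsymm hsmall h i j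
  obtain ⟨C', hC'⟩ := exists_bounds_of_isPerturbedSolution hn hW htree hsymm hsmall h j i
  have hsub := eventually_evalC_sub (X i) (X j)
  refine ⟨degree_num_lt_of_bound (hdecay C) (hC.mono fun s hs hre => (hs hre).1),
    degree_num_lt_of_bound (g := fun s => C * ‖WithLp.toLp 2 fun l => evalC (U l) s‖ / ‖s‖ ^ n +
      C' * ‖WithLp.toLp 2 fun l => evalC (U l) s‖ / ‖s‖ ^ n)
      (by simpa using (hdecay C).add (hdecay C')) ?_, fun z hz => ?_⟩
  · filter_upwards [hC, hC', hsub] with s h1 h2 h3 hs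
    rw [h3]
    exact (norm_sub_le _ _).trans (add_le_add (h1 hs).1 (h2 hs).1)
  · by_contra hre
    -- The bound without the factor `|s|^(-n)` is used here: it stays continuous on the whole closed
    -- half plane, including `s = 0`.
    refine aeval_denom_ne_zero_of_bound
      (g := fun s => C * ‖WithLp.toLp 2 fun l => evalC (U l) s‖) (not_lt.1 hre)
      ((continuousAt_norm_evalC hU (not_lt.1 hre)).const_mul C) ?_ hz
    filter_upwards [hC, hsub] with s h1 h3 hs
    rw [h3]
    exact (h1 hs).2

omit [Fintype ι] [DecidableEq ι] in
/-- Strictly proper transfer functions with stable differences have trajectories, all of which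
reach consensus. -/
theorem exists_isTrajectory_and_achievesConsensus {X : ι → RatFunc ℝ}
    (hX : ∀ i, (X i).num.degree < (X i).denom.degree)
    (hdiff : ∀ i j, (X i - X j).num.degree < (X i - X j).denom.degree)
    (hstable : ∀ i j, ∀ z : ℂ, aeval z (X i - X j).denom = 0 → z.re < 0) (n : ℕ) :
    (∃ x : ι → ℝ → ℝ, IsTrajectory x X) ∧
      ∀ x : ι → ℝ → ℝ, IsTrajectory x X → AchievesConsensus n x := by
  choose y hy hyL using fun i =>
    exists_expPoly_hasLaplaceTransform Set.univ (hX i) fun _ _ => Set.mem_univ _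
  have hsmooth : ∀ {S : Set ℂ} {z : ℝ → ℂ}, z ∈ expPoly S → ∀ m : ℕ,
      ContDiff ℝ m fun t => (z t).re := fun hz m =>
    Complex.reCLM.contDiff.comp (contDiff_of_mem_expPoly hz m)
  have hcont : ∀ {S : Set ℂ} {z : ℝ → ℂ}, z ∈ expPoly S →
      ContinuousOn (fun t => (z t).re) (Set.Ioi 0) := fun hz =>
    (hsmooth hz 0).continuous.continuousOn
  refine ⟨⟨fun i t => (y i t).re, fun i => ⟨hcont (hy i), hyL i⟩⟩, fun x hx => ?_⟩
  have hxs : ∀ i, ∀ m : ℕ, ContDiffOn ℝ m (x i) (Set.Ioi 0) := fun i m =>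
    (hsmooth (hy i) m).contDiffOn.congr
      ((hx i).2.eqOn (hyL i) (hx i).1 (hcont (hy i)))
  refine ⟨fun i => hxs i n, fun i j k _ => ?_⟩
  obtain ⟨z, hz, hzL⟩ := exists_expPoly_hasLaplaceTransform {z : ℂ | z.re < 0} (hdiff i j)
    (hstable i j)
  -- Strict properness of `X i` alone allows growing exponents, so decay has to come from inverting
  -- `X i - X j` directly; uniqueness identifies the two on `t > 0`.
  have heq := ((hx i).2.sub (hx j).2).eqOn hzL ((hx i).1.sub (hx j).1) (hcont hz)
  obtain ⟨w, hw, hwk⟩ := exists_iteratedDeriv_re k hz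
  have hlim : Tendsto (fun t => |(w t).re|) atTop (𝓝 0) := by
    have h := (tendsto_zero_of_mem_expPoly (fun _ h => h) hw)
    have h2 := ((Complex.continuous_re.tendsto 0).comp h).abs
    simpa using h2
  refine hlim.congr' ?_
  filter_upwards [eventually_gt_atTop 0] with t ht
  have hnhds : Set.Ioi (0 : ℝ) ∈ 𝓝 t := Ioi_mem_nhds ht
  have h1 : iteratedDeriv k (x i - x j) t = iteratedDeriv k (x i) t - iteratedDeriv k (x j) t :=
    iteratedDeriv_sub ((hxs i k).contDiffAt hnhds) ((hxs j k).contDiffAt hnhds)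
  have h2 : iteratedDeriv k (x i - x j) t = iteratedDeriv k (fun t => (z t).re) t :=
    Filter.EventuallyEq.iteratedDeriv_eq k (heq.eventuallyEq_of_mem hnhds)
  rw [← h1, h2, hwk]

end System

end SerialConsensus

/-! ### Unique solvability and consensus. -/

theorem mainTheorem4 {ι : Type*} [Fintype ι] [DecidableEq ι] (n : ℕ) (hn : 1 ≤ n)
    (W : Matrix ι ι ℝ) (hW : ∀ i j, 0 ≤ W i j)
    (htree : SerialConsensus.HasConnectedSpanningTree W)
    (hsymm : SerialConsensus.graphLaplacian W = (SerialConsensus.graphLaplacian W).transpose)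
    (Uref : ι → RatFunc ℝ) (hUref : ∀ i, SerialConsensus.IsRHInf (Uref i))
    (Δ : ℕ → Matrix ι ι (RatFunc ℝ)) (hΔ : ∀ k ≤ n, SerialConsensus.MatrixIsRHInf (Δ k))
    (hsmall : SerialConsensus.hInfNorm (Δ 0) + SerialConsensus.hInfNorm (Δ n) +
      ∑ k ∈ Finset.Ioo 0 n, SerialConsensus.hInfNorm (Δ k) *
        ENNReal.ofReal (Real.sqrt ((k : ℝ) ^ k / (n : ℝ) ^ n * ((n : ℝ) - k) ^ (n - k))) < 1) :
    (∃! X : ι → RatFunc ℝ,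
      SerialConsensus.IsPerturbedSolution n (SerialConsensus.graphLaplacian W) Δ Uref X) ∧
    ∀ X : ι → RatFunc ℝ,
      SerialConsensus.IsPerturbedSolution n (SerialConsensus.graphLaplacian W) Δ Uref X →
      (∃ x : ι → ℝ → ℝ, SerialConsensus.IsTrajectory x X) ∧
      ∀ x : ι → ℝ → ℝ, SerialConsensus.IsTrajectory x X →
        SerialConsensus.AchievesConsensus n x := by
  have hsmall' := (SerialConsensus.sum_hInfNorm_mul_gain hn Δ).trans_lt hsmall
  refine ⟨SerialConsensus.existsUnique_isPerturbedSolution (fun X hX => funext fun i => ?_) Uref,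
    fun X hX => ?_⟩
  -- For zero reference the decay bound reads `|X_i(s)| ≤ 0` off a finite subset of the open right
  -- half plane, so each `X_i` has infinitely many zeros. The second index is irrelevant and taken
  -- equal to `i`.
  · obtain ⟨C, hC⟩ := SerialConsensus.exists_bounds_of_isPerturbedSolution hn hW htree hsymm
      hsmall' hX i i
    refine SerialConsensus.eq_zero_of_infinite_evalC_eq_zero SerialConsensus.infinite_re_pos ?_
    filter_upwards [hC] with s hs hre
    have h := (hs hre).1
    simp only [Pi.zero_apply, SerialConsensus.evalC_zero] at h
    rw [show (fun _ : ι => (0 : ℂ)) = 0 from rfl, WithLp.toLp_zero, norm_zero, mul_zero,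
      zero_div] at h
    exact norm_le_zero_iff.1 h
  · have hp := SerialConsensus.poles_of_isPerturbedSolution hn hW htree hsymm hsmall' hUref hX
    exact SerialConsensus.exists_isTrajectory_and_achievesConsensus (fun i => (hp i i).1)
      (fun i j => (hp i j).2.1) (fun i j => (hp i j).2.2) n
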